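/- Let $(M,\mathcal F)$ be a smooth manifold with a transversely affine foliation of dimension $p$ and codimension $q$ (given by an adapted atlas whose transverse coordinate changes are restrictions of affine maps), let $D$ be the corresponding flat connection in the normal bundle $N(M,\mathcal F)=TM/T\mathcal F$, for which the sections $\partial/\partial y^i$ are parallel in every adapted foliated affine coordinate system $(x^1,\dots,x^p,y^1,\dots,y^q)$, and let $g$ be a foliated Hessian metric on $N(M,\mathcal F)$, i.e. a Riemannian metric on the normal bundle which in such coordinates is locally $g=\sum_{i,j}\frac{\partial^2 h}{\partial y^i\partial y^j}\,dy^i\,dy^j$ with $h$ a smooth function of $(y^1,\dots,y^q)$. Let $\nabla$ be the normal Levi-Civita connection of $g$, $\gamma=\nabla-D$, and $Q=D\gamma$ the normal Hessian curvature tensor, so that $Q^i_{jkl}=\partial\gamma^i_{jl}/\partial y^k$ and $Q_{ijkl}=\sum_s g_{is}Q^s_{jkl}$ in adapted foliated affine coordinates. The total space of $\pi:N(M,\mathcal F)\to M$ carries the foliation $\mathcal F^N$ of dimension $p$ and codimension $2q$ with adapted charts $(x^1,\dots,x^p,y^1,\dots,y^q,dy^1,\dots,dy^q)$, transversely holomorphic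 coordinates $z^i=y^i+\sqrt{-1}\,dy^i$, and the normal Kähler metric $$g^N=\sum_{i,j}(g_{ij}\circ\pi)\,dz^i\,d\bar z^j,\qquad\text{i.e. } g^N(a,b)=\operatorname{Re}\sum_{i,j}(g_{ij}\circ\pi)\,dz^i(a)\,\overline{dz^j(b)} .$$ Let $R^N$ be the Riemannian curvature tensor of (the normal Levi-Civita connection of) $g^N$, $R^N(X,Y)=\nabla_X\nabla_Y-\nabla_Y\nabla_X-\nabla_{[X,Y]}$, extended complex multilinearly, with components $R^N\!\left(\frac{\partial}{\partial z^k},\frac{\partial}{\partial\bar z^l}\right)\frac{\partial}{\partial\bar z^j}=\sum_s (R^N)^{\bar s}{}_{\bar jk\bar l}\,\frac{\partial}{\partial\bar z^s}$ and $R^N_{i\bar jk\bar l}=\sum_s g^N_{i\bar s}\,(R^N)^{\bar s}{}_{\bar jk\bar l}$, where $g^N_{i\bar s}=g_{is}\circ\pi$ is the coefficient of $dz^i\,d\bar z^s$ in $g^N$. Then for every adapted foliated affine coordinate system of $(M,\mathcal F)$ and all $i,j,k,l=1,\dots,q$, $$R^N_{i\bar jk\bar l}=\tfrac12\,Q_{ijkl}\circ\pi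 .$$ -/

import Mathlib

open scoped Manifold ContDiff Topology

noncomputable section

namespace HessFol

/-! ### Transversely affine foliations -/

/-- The model `ℝ^p × ℝ^ι` of a foliated manifold: the first factor carries the leaf coordinates
`x^1, …, x^p`, the second one the transverse coordinates `y^i`, `i ∈ ι`. -/
abbrev Model (p : ℕ) (ι : Type) : Type := (Fin p → ℝ) × (ι → ℝ)

/-- Smooth maps `(x, y) ↦ (a (x, y), k y)` (locally) with `k` locally the restriction of an
affine map. -/
def affineFoliationPregroupoid (p : ℕ) (ι : Type) [Fintype ι] : Pregroupoid (Model p ι) where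
  property f s := ContDiffOn ℝ ∞ f s ∧ ∀ z ∈ s, ∃ (L : (ι → ℝ) →ₗ[ℝ] (ι → ℝ)) (b : ι → ℝ),
    ∀ᶠ w in 𝓝 z, (f w).2 = L w.2 + b
  comp := by
    rintro f g u v ⟨hf, hf'⟩ ⟨hg, hg'⟩ hu hv -
    refine ⟨hg.comp (hf.mono Set.inter_subset_left) fun x hx => hx.2, ?_⟩
    rintro z ⟨hzu, hzv⟩
    obtain ⟨L, b, h⟩ := hf' z hzu
    obtain ⟨L', b', h'⟩ := hg' (f z) hzv
    refine ⟨L' ∘ₗ L, L' b + b', ?_⟩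
    have hc : ContinuousAt f z := (hf.continuousOn.continuousAt (hu.mem_nhds hzu))
    filter_upwards [h, hc.eventually h'] with w h1 h2
    simp [h1, h2, add_assoc]
  id_mem := ⟨contDiffOn_id, fun z _ => ⟨LinearMap.id, 0, by simp⟩⟩
  locality := by
    intro f u hu h
    constructor
    · intro x hx
      obtain ⟨v, hv, hxv, h1, -⟩ := h x hx
      exact (h1.contDiffAt ((hu.inter hv).mem_nhds ⟨hx, hxv⟩)).contDiffWithinAt
    · intro x hx
      obtain ⟨v, hv, hxv, -, h2⟩ := h x hx
      exact h2 x ⟨hx, hxv⟩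
  congr := by
    rintro f g u hu h ⟨h1, h2⟩
    refine ⟨h1.congr h, fun z hz => ?_⟩
    obtain ⟨L, b, h'⟩ := h2 z hz
    refine ⟨L, b, ?_⟩
    filter_upwards [h', hu.mem_nhds hz] with w hw hwu
    rw [h w hwu, hw]

/-- The pseudogroup of changes of adapted affine coordinates. A charted space over `Model p ι`
with this structure groupoid is a smooth manifold with a transversely affine foliation of
dimension `p` and codimension `card ι`. -/
def affineFoliationGroupoid (p : ℕ) (ι : Type) [Fintype ι] : StructureGroupoid (Model p ι) :=
  (affineFoliationPregroupoid p ι).groupoid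

/-- All adapted foliated affine coordinate systems `(x^1, …, x^p, y^i)` of a manifold with a
transversely affine foliation. -/
abbrev AffineCharts (p : ℕ) (ι : Type) [Fintype ι] (M : Type*) [TopologicalSpace M]
    [ChartedSpace (Model p ι) M] : Set (OpenPartialHomeomorph M (Model p ι)) :=
  (affineFoliationGroupoid p ι).maximalAtlas M

section Foliation

variable {p : ℕ} {ι : Type} [Fintype ι] {M : Type*} [TopologicalSpace M]
  [ChartedSpace (Model p ι) M]

lemma affineFoliationGroupoid_le :
    affineFoliationGroupoid p ι ≤ contDiffGroupoid ∞ 𝓘(ℝ, Model p ι) := by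
  intro e he
  change e ∈ (contDiffPregroupoid ∞ 𝓘(ℝ, Model p ι)).groupoid
  rw [mem_groupoid_of_pregroupoid]
  simpa [contDiffPregroupoid] using And.intro he.1.1 he.2.1

instance isManifold [HasGroupoid M (affineFoliationGroupoid p ι)] :
    IsManifold 𝓘(ℝ, Model p ι) ∞ M :=
  have := hasGroupoid_of_le (M := M) (G₁ := affineFoliationGroupoid p ι) inferInstance
    affineFoliationGroupoid_le
  IsManifold.mk' _ _ _

lemma mem_maximalAtlas_of_affine {e : OpenPartialHomeomorph M (Model p ι)}
    (he : e ∈ AffineCharts p ι M) : e ∈ IsManifold.maximalAtlas 𝓘(ℝ, Model p ι) ∞ M :=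
  StructureGroupoid.maximalAtlas_mono affineFoliationGroupoid_le he

/-- The differential at `x` of the transverse coordinates `(y^i)` of a chart. -/
def dyTangent (e : OpenPartialHomeomorph M (Model p ι)) (x : M) :
    TangentSpace 𝓘(ℝ, Model p ι) x →ₗ[ℝ] (ι → ℝ) :=
  (mfderiv 𝓘(ℝ, Model p ι) 𝓘(ℝ, ι → ℝ) (fun w => (e w).2) x).toLinearMap

variable (p ι) in
/-- The tangent space `T_x 𝓕` of the leaf through `x`. -/
def leafTangent (x : M) : Submodule ℝ (TangentSpace 𝓘(ℝ, Model p ι) x) :=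
  LinearMap.ker (dyTangent (chartAt (Model p ι) x) x)

variable (p ι) in
/-- The fibre `T_x M / T_x 𝓕` of the normal bundle of the foliation. -/
abbrev NormalSpace (x : M) : Type := TangentSpace 𝓘(ℝ, Model p ι) x ⧸ leafTangent p ι x

/-- The map `ξ ↦ ∑ i, ξ^i ∂/∂y^i` into the normal space at `x`, for a chart `e` around `x`. -/
def normalFrame (e : OpenPartialHomeomorph M (Model p ι)) (x : M) :
    (ι → ℝ) →ₗ[ℝ] NormalSpace p ι x :=
  (leafTangent p ι x).mkQ ∘ₗ
    (show Model p ι →L[ℝ] TangentSpace 𝓘(ℝ, Model p ι) x from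
      mfderiv 𝓘(ℝ, Model p ι) 𝓘(ℝ, Model p ι) e.symm (e x)).toLinearMap ∘ₗ
    LinearMap.inr ℝ (Fin p → ℝ) (ι → ℝ)

open Classical in
/-- The coordinates `(dy^i)` on the normal space at `x`, for a chart `e` around `x`: the map
induced on the quotient by `dyTangent e x`. -/
def normalDy (e : OpenPartialHomeomorph M (Model p ι)) (x : M) :
    NormalSpace p ι x →ₗ[ℝ] (ι → ℝ) :=
  if h : leafTangent p ι x ≤ LinearMap.ker (dyTangent e x) then
    (leafTangent p ι x).liftQ (dyTangent e x) h
  else 0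

lemma mdifferentiableAt_chart {e : OpenPartialHomeomorph M (Model p ι)}
    (he : e ∈ AffineCharts p ι M) {x : M} (hx : x ∈ e.source) :
    MDifferentiableAt 𝓘(ℝ, Model p ι) 𝓘(ℝ, Model p ι) e x :=
  (contMDiffAt_of_mem_maximalAtlas (mem_maximalAtlas_of_affine he) hx).mdifferentiableAt
    (by simp)

lemma mdifferentiableAt_chart_symm {e : OpenPartialHomeomorph M (Model p ι)}
    (he : e ∈ AffineCharts p ι M) {z : Model p ι} (hz : z ∈ e.target) :
    MDifferentiableAt 𝓘(ℝ, Model p ι) 𝓘(ℝ, Model p ι) e.symm z :=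
  (contMDiffAt_symm_of_mem_maximalAtlas (mem_maximalAtlas_of_affine he) hz).mdifferentiableAt
    (by simp)

lemma mdifferentiableAt_snd {z : Model p ι} :
    MDifferentiableAt 𝓘(ℝ, Model p ι) 𝓘(ℝ, ι → ℝ) (Prod.snd : Model p ι → (ι → ℝ)) z :=
  differentiableAt_snd.mdifferentiableAt

lemma transition_affine {e e' : OpenPartialHomeomorph M (Model p ι)}
    (he : e ∈ AffineCharts p ι M) (he' : e' ∈ AffineCharts p ι M) {x : M}
    (hx : x ∈ e.source) (hx' : x ∈ e'.source) :
    ∃ (L : (ι → ℝ) →ₗ[ℝ] (ι → ℝ)) (b : ι → ℝ),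
      ∀ᶠ w in 𝓝 x, (e' w).2 = L (e w).2 + b := by
  have h := ((affineFoliationGroupoid p ι).compatible_of_mem_maximalAtlas he he').1.2
  obtain ⟨L, b, h⟩ := h (e x) (by simp [hx, hx'])
  refine ⟨L, b, ?_⟩
  filter_upwards [(e.continuousAt hx).eventually h, e.open_source.mem_nhds hx] with w hw hw'
  simpa [e.left_inv hw'] using hw

lemma dyTangent_eq_of_affine {e e' : OpenPartialHomeomorph M (Model p ι)}
    (he : e ∈ AffineCharts p ι M) {x : M} (hx : x ∈ e.source)
    {L : (ι → ℝ) →ₗ[ℝ] (ι → ℝ)} {b : ι → ℝ} (h : ∀ᶠ w in 𝓝 x, (e' w).2 = L (e w).2 + b) :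
    dyTangent e' x = L ∘ₗ dyTangent e x := by
  have h1 : MDifferentiableAt 𝓘(ℝ, Model p ι) 𝓘(ℝ, ι → ℝ) (fun w => (e w).2) x :=
    mdifferentiableAt_snd.comp x (mdifferentiableAt_chart he hx)
  have h2 : HasMFDerivAt 𝓘(ℝ, ι → ℝ) 𝓘(ℝ, ι → ℝ) (fun y => L y + b) ((e x).2)
      (show (ι → ℝ) →L[ℝ] (ι → ℝ) from LinearMap.toContinuousLinearMap L) :=
    hasMFDerivAt_iff_hasFDerivAt.2
      ((LinearMap.toContinuousLinearMap L).hasFDerivAt.add_const b)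
  have h3 := h2.comp x h1.hasMFDerivAt
  have h4 : (fun w => (e' w).2) =ᶠ[𝓝 x] (fun y => L y + b) ∘ (fun w => (e w).2) := h
  rw [dyTangent, (h3.congr_of_eventuallyEq h4).mfderiv]
  rfl

variable [HasGroupoid M (affineFoliationGroupoid p ι)]

lemma leafTangent_eq_ker {e : OpenPartialHomeomorph M (Model p ι)}
    (he : e ∈ AffineCharts p ι M) {x : M} (hx : x ∈ e.source) :
    leafTangent p ι x = LinearMap.ker (dyTangent e x) := by
  have hc := (affineFoliationGroupoid p ι).chart_mem_maximalAtlas x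
  have hxc := mem_chart_source (Model p ι) x
  obtain ⟨L, b, h⟩ := transition_affine hc he hxc hx
  obtain ⟨L', b', h'⟩ := transition_affine he hc hx hxc
  have h1 := dyTangent_eq_of_affine hc hxc h
  have h2 := dyTangent_eq_of_affine he hx h'
  refine le_antisymm (fun v hv => ?_) (fun v hv => ?_)
  · rw [leafTangent, LinearMap.mem_ker] at hv
    rw [LinearMap.mem_ker, h1, LinearMap.comp_apply, hv, map_zero]
  · rw [LinearMap.mem_ker] at hv
    rw [leafTangent, LinearMap.mem_ker, h2, LinearMap.comp_apply, hv, map_zero]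

lemma normalDy_mk {e : OpenPartialHomeomorph M (Model p ι)}
    (he : e ∈ AffineCharts p ι M) {x : M} (hx : x ∈ e.source)
    (v : TangentSpace 𝓘(ℝ, Model p ι) x) :
    normalDy e x ((leafTangent p ι x).mkQ v) = dyTangent e x v := by
  rw [normalDy, dif_pos (leafTangent_eq_ker he hx).le]
  rfl

lemma normalDy_injective {e : OpenPartialHomeomorph M (Model p ι)}
    (he : e ∈ AffineCharts p ι M) {x : M} (hx : x ∈ e.source) :
    Function.Injective (normalDy e x) := by
  rw [injective_iff_map_eq_zero]
  intro a ha
  obtain ⟨v, rfl⟩ := Submodule.mkQ_surjective _ a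
  rw [normalDy_mk he hx] at ha
  rw [Submodule.mkQ_apply, Submodule.Quotient.mk_eq_zero, leafTangent_eq_ker he hx]
  exact ha

lemma normalDy_normalFrame {e : OpenPartialHomeomorph M (Model p ι)}
    (he : e ∈ AffineCharts p ι M) {x : M} (hx : x ∈ e.source) (ξ : ι → ℝ) :
    normalDy e x (normalFrame e x ξ) = ξ := by
  rw [normalFrame, LinearMap.comp_apply, normalDy_mk he hx]
  have hz := e.map_source hx
  have h1 : MDifferentiableAt 𝓘(ℝ, Model p ι) 𝓘(ℝ, ι → ℝ) (fun w => (e w).2) (e.symm (e x)) := by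
    rw [e.left_inv hx]
    exact mdifferentiableAt_snd.comp x (mdifferentiableAt_chart he hx)
  have h2 := h1.hasMFDerivAt.comp (e x) (mdifferentiableAt_chart_symm he hz).hasMFDerivAt
  have h3 : HasMFDerivAt 𝓘(ℝ, Model p ι) 𝓘(ℝ, ι → ℝ) (Prod.snd : Model p ι → (ι → ℝ)) (e x)
      (show Model p ι →L[ℝ] (ι → ℝ) from ContinuousLinearMap.snd ℝ (Fin p → ℝ) (ι → ℝ)) :=
    hasMFDerivAt_iff_hasFDerivAt.2 hasFDerivAt_snd
  have h4 := h3.congr_of_eventuallyEq (f₁ := (fun w => (e w).2) ∘ e.symm) (by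
    filter_upwards [e.open_target.mem_nhds hz] with w hw
    simp [e.right_inv hw])
  have h5 := hasMFDerivAt_unique h2 h4
  have h6 := congrArg (fun T : Model p ι →L[ℝ] (ι → ℝ) => T (0, ξ)) h5
  rw [e.left_inv hx] at h6
  exact h6

lemma normalFrame_normalDy {e : OpenPartialHomeomorph M (Model p ι)}
    (he : e ∈ AffineCharts p ι M) {x : M} (hx : x ∈ e.source) (a : NormalSpace p ι x) :
    normalFrame e x (normalDy e x a) = a :=
  normalDy_injective he hx (normalDy_normalFrame he hx _)

lemma normalDy_eq_of_affine {e e' : OpenPartialHomeomorph M (Model p ι)}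
    (he : e ∈ AffineCharts p ι M) (he' : e' ∈ AffineCharts p ι M) {x : M}
    (hx : x ∈ e.source) (hx' : x ∈ e'.source)
    {L : (ι → ℝ) →ₗ[ℝ] (ι → ℝ)} {b : ι → ℝ} (h : ∀ᶠ w in 𝓝 x, (e' w).2 = L (e w).2 + b)
    (a : NormalSpace p ι x) :
    normalDy e' x a = L (normalDy e x a) := by
  obtain ⟨v, rfl⟩ := Submodule.mkQ_surjective _ a
  rw [normalDy_mk he hx, normalDy_mk he' hx', dyTangent_eq_of_affine he hx h]
  rfl

end Foliation

/-! ### The normal bundle `N(M, 𝓕)` and its foliation `𝓕^N` -/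

/-- The total space of the normal bundle `N(M, 𝓕) = TM / T𝓕`. -/
structure NormalBundle (p : ℕ) (ι : Type) [Fintype ι] (M : Type*) [TopologicalSpace M]
    [ChartedSpace (Model p ι) M] where
  /-- The natural projection `N(M, 𝓕) → M`. -/
  proj : M
  /-- The normal vector. -/
  vec : NormalSpace p ι proj

section NormalBundle

variable {p : ℕ} {ι : Type} [Fintype ι] {M : Type*} [TopologicalSpace M]
  [ChartedSpace (Model p ι) M] [HasGroupoid M (affineFoliationGroupoid p ι)]

/-- The chart `(x^1, …, x^p, y^i, dy^i)` of the normal bundle induced by an adapted chart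
`(x^1, …, x^p, y^i)`. The transverse coordinates are indexed by `ι ⊕ ι`: `y^i` has index
`Sum.inl i`, and `dy^i` has index `Sum.inr i`. -/
def normalChartEquiv (e : OpenPartialHomeomorph M (Model p ι)) (he : e ∈ AffineCharts p ι M) :
    PartialEquiv (NormalBundle p ι M) (Model p (ι ⊕ ι)) where
  toFun u := ((e u.proj).1, Sum.elim (e u.proj).2 (normalDy e u.proj u.vec))
  invFun z := ⟨e.symm (z.1, z.2 ∘ Sum.inl), normalFrame e _ (z.2 ∘ Sum.inr)⟩
  source := {u | u.proj ∈ e.source}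
  target := {z | (z.1, z.2 ∘ Sum.inl) ∈ e.target}
  map_source' u hu := by simpa using e.map_source hu
  map_target' z hz := e.map_target hz
  left_inv' := by
    rintro ⟨x, a⟩ hx
    change x ∈ e.source at hx
    have h : e.symm (e x) = x := e.left_inv hx
    change NormalBundle.mk (e.symm (e x)) (normalFrame e (e.symm (e x)) (normalDy e x a)) = _
    rw [h, normalFrame_normalDy he hx]
  right_inv' := by
    rintro ⟨x, y⟩ hz
    change (x, y ∘ Sum.inl) ∈ e.target at hz
    dsimp only
    rw [normalDy_normalFrame he (e.map_target hz), e.right_inv hz]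
    simp

/-- In the charts induced by `e` and `e'` the change of coordinates is
`(x, y, ξ) ↦ (a (x, y), L y + b, L ξ)` near any point, if the one between `e` and `e'` is
`(x, y) ↦ (a (x, y), L y + b)`. -/
lemma normalChartEquiv_transition {e e' : OpenPartialHomeomorph M (Model p ι)}
    (he : e ∈ AffineCharts p ι M) (he' : e' ∈ AffineCharts p ι M) {z : Model p (ι ⊕ ι)}
    (hz : z ∈ ((normalChartEquiv e he).symm.trans (normalChartEquiv e' he')).source) :
    ∃ (L : (ι → ℝ) →ₗ[ℝ] (ι → ℝ)) (b : ι → ℝ), ∀ᶠ w in 𝓝 z,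
      ((normalChartEquiv e he).symm.trans (normalChartEquiv e' he')) w =
        ((e' (e.symm (w.1, w.2 ∘ Sum.inl))).1,
          Sum.elim (L (w.2 ∘ Sum.inl) + b) (L (w.2 ∘ Sum.inr))) := by
  obtain ⟨hz1, hz2⟩ := hz
  change (z.1, z.2 ∘ Sum.inl) ∈ e.target at hz1
  change e.symm (z.1, z.2 ∘ Sum.inl) ∈ e'.source at hz2
  obtain ⟨L, b, h⟩ := transition_affine he he' (e.map_target hz1) hz2
  refine ⟨L, b, ?_⟩
  have hc : ContinuousAt (fun w : Model p (ι ⊕ ι) => ((w.1, w.2 ∘ Sum.inl) : Model p ι)) z := by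
    fun_prop
  have hc' : ContinuousAt (fun w : Model p (ι ⊕ ι) => e.symm (w.1, w.2 ∘ Sum.inl)) z :=
    ContinuousAt.comp (f := fun w : Model p (ι ⊕ ι) => ((w.1, w.2 ∘ Sum.inl) : Model p ι))
      (e.continuousAt_symm hz1) hc
  filter_upwards [hc (e.open_target.mem_nhds hz1), hc'.eventually h.eventually_nhds,
    hc' (e'.open_source.mem_nhds hz2)] with w hw1 hw2 hw3
  change (w.1, w.2 ∘ Sum.inl) ∈ e.target at hw1
  change e.symm (w.1, w.2 ∘ Sum.inl) ∈ e'.source at hw3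
  change ((e' (e.symm (w.1, w.2 ∘ Sum.inl))).1, Sum.elim (e' (e.symm (w.1, w.2 ∘ Sum.inl))).2
    (normalDy e' _ (normalFrame e (e.symm (w.1, w.2 ∘ Sum.inl)) (w.2 ∘ Sum.inr)))) = _
  rw [normalDy_eq_of_affine he he' (e.map_target hw1) hw3 hw2,
    normalDy_normalFrame he (e.map_target hw1), hw2.self_of_nhds, e.right_inv hw1]

lemma normalChartEquiv_transition_source {e e' : OpenPartialHomeomorph M (Model p ι)}
    (he : e ∈ AffineCharts p ι M) (he' : e' ∈ AffineCharts p ι M) :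
    ((normalChartEquiv e he).symm.trans (normalChartEquiv e' he')).source =
      (fun w : Model p (ι ⊕ ι) => ((w.1, w.2 ∘ Sum.inl) : Model p ι)) ⁻¹'
        (e.symm.trans e').source := by
  ext z
  rfl

lemma normalChartEquiv_transition_mem {e e' : OpenPartialHomeomorph M (Model p ι)}
    (he : e ∈ AffineCharts p ι M) (he' : e' ∈ AffineCharts p ι M) :
    (affineFoliationPregroupoid p (ι ⊕ ι)).property
      ((normalChartEquiv e he).symm.trans (normalChartEquiv e' he'))
      ((normalChartEquiv e he).symm.trans (normalChartEquiv e' he')).source := by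
  constructor
  · intro z hz
    obtain ⟨L, b, h⟩ := normalChartEquiv_transition he he' hz
    have hs := ((affineFoliationGroupoid p ι).compatible_of_mem_maximalAtlas he he').1.1
    have hz' : (z.1, z.2 ∘ Sum.inl) ∈ (e.symm.trans e').source := hz
    have hs' := hs.contDiffAt ((e.symm.trans e').open_source.mem_nhds hz')
    have hl (s : ι → ι ⊕ ι) :
        ContDiff ℝ ∞ (fun w : Model p (ι ⊕ ι) => (w.2 ∘ s : ι → ℝ)) := by
      rw [contDiff_pi]
      intro i
      exact (contDiff_apply ℝ ℝ (s i)).comp contDiff_snd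
    have h1 : ContDiffAt ℝ ∞ (fun w : Model p (ι ⊕ ι) =>
        (e' (e.symm (w.1, w.2 ∘ Sum.inl))).1) z :=
      (ContDiffAt.comp (f := fun w : Model p (ι ⊕ ι) => ((w.1, w.2 ∘ Sum.inl) : Model p ι)) z
        hs' (contDiff_fst.prodMk (hl _)).contDiffAt).fst
    have hL : ContDiff ℝ ∞ L := (LinearMap.toContinuousLinearMap L).contDiff
    refine (ContDiffAt.congr_of_eventuallyEq (h1.prodMk ?_) h).contDiffWithinAt
    rw [contDiffAt_pi]
    rintro (i | i)
    · exact (contDiff_pi.1 ((hL.comp (hl Sum.inl)).add contDiff_const) i).contDiffAt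
    · exact (contDiff_pi.1 (hL.comp (hl Sum.inr)) i).contDiffAt
  · intro z hz
    obtain ⟨L, b, h⟩ := normalChartEquiv_transition he he' hz
    refine ⟨{ toFun := fun v => Sum.elim (L (v ∘ Sum.inl)) (L (v ∘ Sum.inr))
              map_add' := fun v w => ?_
              map_smul' := fun c v => ?_ }, Sum.elim b 0, ?_⟩
    · have h1 (s : ι → ι ⊕ ι) : (v + w) ∘ s = v ∘ s + w ∘ s := rfl
      ext (i | i) <;> simp [h1]
    · have h1 (s : ι → ι ⊕ ι) : (c • v) ∘ s = c • (v ∘ s) := rfl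
      ext (i | i) <;> simp [h1]
    · filter_upwards [h] with w hw
      rw [hw]
      ext (i | i) <;> simp

variable (p ι M) in
/-- The atlas of `N(M, 𝓕)` formed by the charts induced by all adapted affine charts of `M`. -/
def normalBundleCore : ChartedSpaceCore (Model p (ι ⊕ ι)) (NormalBundle p ι M) where
  atlas := {E | ∃ e, ∃ he : e ∈ AffineCharts p ι M, E = normalChartEquiv e he}
  chartAt u := normalChartEquiv (chartAt (Model p ι) u.proj)
    ((affineFoliationGroupoid p ι).chart_mem_maximalAtlas u.proj)
  mem_chart_source u := mem_chart_source (Model p ι) u.proj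
  chart_mem_atlas u := ⟨_, _, rfl⟩
  open_source := by
    rintro _ _ ⟨e, he, rfl⟩ ⟨e', he', rfl⟩
    rw [normalChartEquiv_transition_source]
    exact (e.symm.trans e').open_source.preimage (by fun_prop)
  continuousOn_toFun := by
    rintro _ _ ⟨e, he, rfl⟩ ⟨e', he', rfl⟩
    exact (normalChartEquiv_transition_mem he he').1.continuousOn

instance normalBundleTopology : TopologicalSpace (NormalBundle p ι M) :=
  (normalBundleCore p ι M).toTopologicalSpace

instance normalBundleChartedSpace : ChartedSpace (Model p (ι ⊕ ι)) (NormalBundle p ι M) :=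
  (normalBundleCore p ι M).toChartedSpace

/-- The adapted affine chart of `(N(M, 𝓕), 𝓕^N)` induced by an adapted affine chart of
`(M, 𝓕)`. -/
def normalChart (e : OpenPartialHomeomorph M (Model p ι)) (he : e ∈ AffineCharts p ι M) :
    OpenPartialHomeomorph (NormalBundle p ι M) (Model p (ι ⊕ ι)) :=
  (normalBundleCore p ι M).openPartialHomeomorph (normalChartEquiv e he) ⟨e, he, rfl⟩

/-- The charts `normalChart e he` define the foliation `𝓕^N` of `N(M, 𝓕)`, of dimension `p` and
of twice the codimension; it is transversely affine. -/
instance normalBundleFoliation :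
    HasGroupoid (NormalBundle p ι M) (affineFoliationGroupoid p (ι ⊕ ι)) where
  compatible := by
    intro E E' hE hE'
    obtain ⟨_, ⟨e, rfl⟩, hE⟩ := hE
    obtain ⟨_, ⟨⟨e, he, rfl⟩, rfl⟩, rfl⟩ := hE
    obtain ⟨_, ⟨e', rfl⟩, hE'⟩ := hE'
    obtain ⟨_, ⟨⟨e', he', rfl⟩, rfl⟩, rfl⟩ := hE'
    exact ⟨normalChartEquiv_transition_mem he he', normalChartEquiv_transition_mem he' he⟩

lemma normalChart_mem (e : OpenPartialHomeomorph M (Model p ι)) (he : e ∈ AffineCharts p ι M) :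
    normalChart e he ∈ AffineCharts p (ι ⊕ ι) (NormalBundle p ι M) := by
  apply StructureGroupoid.subset_maximalAtlas
  exact Set.mem_iUnion₂.2 ⟨normalChartEquiv e he, ⟨e, he, rfl⟩, rfl⟩

end NormalBundle
/-! ### Normal connections and curvatures in adapted coordinates -/

section LocalFormulas

variable {p : ℕ} {κ : Type} [Fintype κ] [DecidableEq κ]

/-- The partial derivative `∂f/∂y^k` with respect to a transverse coordinate. -/
def pd (f : Model p κ → ℝ) (k : κ) (z : Model p κ) : ℝ :=
  fderiv ℝ f z (0, Pi.single k 1)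

/-- The coefficients `Γ^i_{kj}` of the normal Levi-Civita connection of a foliated metric with
matrix `G = (g_{ij})` in an adapted chart:
`∇_{∂/∂y^k} ∂/∂y^j = ∑ i, Γ^i_{kj} ∂/∂y^i` (and `∇_X ∂/∂y^j = 0` for `X` tangent to the leaves). -/
def leviCivita (G : Model p κ → Matrix κ κ ℝ) (i k j : κ) (z : Model p κ) : ℝ :=
  (1 / 2) * ∑ s, (G z)⁻¹ i s *
    (pd (fun w => G w s j) k z + pd (fun w => G w s k) j z - pd (fun w => G w k j) s z)

/-- The components `R^i_{jkl}` of the curvature of the normal connection with coefficients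
`C^i_{kj}`: `R(∂/∂y^k, ∂/∂y^l) ∂/∂y^j = ∑ i, R^i_{jkl} ∂/∂y^i`, where
`R(X, Y) = ∇_X ∇_Y - ∇_Y ∇_X - ∇_[X, Y]`. -/
def connectionCurvature (C : κ → κ → κ → Model p κ → ℝ) (i j k l : κ) (z : Model p κ) : ℝ :=
  pd (C i l j) k z - pd (C i k j) l z + ∑ m, (C i k m z * C m l j z - C i l m z * C m k j z)

/-- The components `(∇_{∂/∂y^k} T)^i_{jl}` of the covariant derivative of a normal tensor field
`T^i_{jl}` of type `(1, 2)` with respect to the normal connection with coefficients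
`C^i_{kj}`. -/
def covDerivTensor (C : κ → κ → κ → Model p κ → ℝ) (T : κ → κ → κ → Model p κ → ℝ)
    (i j k l : κ) (z : Model p κ) : ℝ :=
  pd (T i j l) k z + ∑ s, (C i k s z * T s j l z - C s k j z * T i s l z - C s k l z * T i j s z)

/-- The coefficients of the flat connection `D` in adapted affine coordinates: the sections
`∂/∂y^j` are parallel. -/
def flatConnection (_i _k _j : κ) (_z : Model p κ) : ℝ := 0

/-- The difference tensor `γ = ∇ - D`, with components `γ^i_{jl}`. -/
def differenceTensor (G : Model p κ → Matrix κ κ ℝ) (i j l : κ) (z : Model p κ) : ℝ :=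
  leviCivita G i j l z - flatConnection i j l z

end LocalFormulas

section Metrics

variable {p : ℕ} {κ : Type} [Fintype κ] [DecidableEq κ] {X : Type*} [TopologicalSpace X]
  [ChartedSpace (Model p κ) X]

/-- The matrix `g_{ij} = g(∂/∂y^i, ∂/∂y^j)` of a normal bilinear form in an adapted chart, as a
function of the coordinates. -/
def components (g : ∀ x : X, LinearMap.BilinForm ℝ (NormalSpace p κ x))
    (e : OpenPartialHomeomorph X (Model p κ)) (z : Model p κ) : Matrix κ κ ℝ :=
  Matrix.of fun i j => g (e.symm z) (normalFrame e (e.symm z) (Pi.single i 1))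
    (normalFrame e (e.symm z) (Pi.single j 1))

end Metrics

/-- A foliated Hessian metric of a transversely affine foliation: a Riemannian metric on the normal
bundle which in adapted affine coordinates is locally `∑ ∂²h/∂y^i∂y^j dy^i dy^j` for a smooth basic
function `h` (a function of the transverse coordinates only). -/
structure FoliatedHessianMetric (p : ℕ) (ι : Type) [Fintype ι] [DecidableEq ι] (M : Type*)
    [TopologicalSpace M] [ChartedSpace (Model p ι) M] where
  /-- The inner product on each normal space. -/
  inner : ∀ x : M, LinearMap.BilinForm ℝ (NormalSpace p ι x)
  symm : ∀ x v w, inner x v w = inner x w v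
  pos : ∀ x v, v ≠ 0 → 0 < inner x v v
  hessian : ∀ e ∈ AffineCharts p ι M, ∀ z ∈ e.target,
    ∃ (h : (ι → ℝ) → ℝ) (W : Set (ι → ℝ)), IsOpen W ∧ z.2 ∈ W ∧ ContDiffOn ℝ ∞ h W ∧
      ∀ᶠ w in 𝓝 z, ∀ i j, components inner e w i j =
        pd (pd (fun w' : Model p ι => h w'.2) j) i w

/-- The components `Q_{ijkl} = ∑ s, g_{is} Q^s_{jkl}` of the normal Hessian curvature tensor
`Q = Dγ` in an adapted affine chart, where `Q^s_{jkl} = (D_{∂/∂y^k} γ)^s_{jl}`. -/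
def hessianCurvature {p : ℕ} {ι : Type} [Fintype ι] [DecidableEq ι] {M : Type*}
    [TopologicalSpace M] [ChartedSpace (Model p ι) M] (g : FoliatedHessianMetric p ι M)
    (e : OpenPartialHomeomorph M (Model p ι)) (i j k l : ι) (z : Model p ι) : ℝ :=
  ∑ s, components g.inner e z i s *
    covDerivTensor flatConnection (differenceTensor (components g.inner e)) s j k l z

/-! ### The normal Kähler metric `g^N` and its curvature -/

section Kahler

variable {p : ℕ} {ι : Type} [Fintype ι] [DecidableEq ι] {M : Type*} [TopologicalSpace M]
  [ChartedSpace (Model p ι) M] [HasGroupoid M (affineFoliationGroupoid p ι)]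

/-- The differential of the transversely holomorphic coordinate `z^i = y^i + √-1 dy^i` on the
normal space to `𝓕^N` at `u`, for the chart of `N(M, 𝓕)` induced by `e`. -/
def dz (e : OpenPartialHomeomorph M (Model p ι)) (he : e ∈ AffineCharts p ι M)
    (u : NormalBundle p ι M) (i : ι) (a : NormalSpace p (ι ⊕ ι) u) : ℂ :=
  (normalDy (normalChart e he) u a (Sum.inl i) : ℂ) +
    Complex.I * (normalDy (normalChart e he) u a (Sum.inr i) : ℂ)

/-- The normal metric `g^N = ∑ (g_{ij} ∘ π) dz^i dz̄^j` of `(N(M, 𝓕), 𝓕^N)`, that is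
`g^N(a, b) = Re ∑ g_{ij}(π u) dz^i(a) conj (dz^j(b))`, written in the preferred adapted affine
chart at `π u`. -/
def normalKahlerMetric (g : FoliatedHessianMetric p ι M) (u : NormalBundle p ι M) :
    LinearMap.BilinForm ℝ (NormalSpace p (ι ⊕ ι) u) :=
  let e := chartAt (Model p ι) u.proj
  let he := (affineFoliationGroupoid p ι).chart_mem_maximalAtlas u.proj
  LinearMap.mk₂ ℝ
    (fun a b => (∑ i, ∑ j, (components g.inner e (e u.proj) i j : ℂ) *
      (dz e he u i a * (starRingEnd ℂ) (dz e he u j b))).re)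
    (by
      intro a a' b
      rw [← Complex.add_re, ← Finset.sum_add_distrib]
      congr 1
      refine Finset.sum_congr rfl fun i _ => ?_
      rw [← Finset.sum_add_distrib]
      refine Finset.sum_congr rfl fun j _ => ?_
      simp only [dz, map_add, Pi.add_apply, Complex.ofReal_add]
      ring)
    (by
      intro c a b
      rw [smul_eq_mul, ← Complex.re_ofReal_mul, Finset.mul_sum]
      congr 1
      refine Finset.sum_congr rfl fun i _ => ?_
      rw [Finset.mul_sum]
      refine Finset.sum_congr rfl fun j _ => ?_
      simp only [dz, map_smul, Pi.smul_apply, smul_eq_mul, Complex.ofReal_mul]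
      ring)
    (by
      intro a b b'
      rw [← Complex.add_re, ← Finset.sum_add_distrib]
      congr 1
      refine Finset.sum_congr rfl fun i _ => ?_
      rw [← Finset.sum_add_distrib]
      refine Finset.sum_congr rfl fun j _ => ?_
      simp only [dz, map_add, map_mul, Pi.add_apply, Complex.ofReal_add]
      ring)
    (by
      intro c a b
      rw [smul_eq_mul, ← Complex.re_ofReal_mul, Finset.mul_sum]
      congr 1
      refine Finset.sum_congr rfl fun i _ => ?_
      rw [Finset.mul_sum]
      refine Finset.sum_congr rfl fun j _ => ?_
      simp only [dz, map_add, map_mul, map_smul, Pi.smul_apply, smul_eq_mul,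
        Complex.ofReal_mul, Complex.conj_ofReal]
      ring)

end Kahler

section ComplexComponents

variable {p : ℕ} {ι : Type} [Fintype ι] [DecidableEq ι]

/-- The real coordinates of the complex tangent vector
`∂/∂z^i = (1/2) (∂/∂y^i - √-1 ∂/∂(dy^i))`. -/
def ddz (i : ι) : ι ⊕ ι → ℂ :=
  Sum.elim (Pi.single i (1 / 2)) (Pi.single i (-(Complex.I / 2)))

/-- The real coordinates of the complex tangent vector
`∂/∂z̄^i = (1/2) (∂/∂y^i + √-1 ∂/∂(dy^i))`. -/
def ddzbar (i : ι) : ι ⊕ ι → ℂ :=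
  Sum.elim (Pi.single i (1 / 2)) (Pi.single i (Complex.I / 2))

/-- Twice the complex bilinear extension of a real bilinear form. The factor is chosen such that
for a Hermitian metric `∑ g_{ij̄} dz^i dz̄^j` (real part of the Hermitian form with matrix
`g_{ij̄}`) the coefficient `g_{ij̄}` is the pairing of `∂/∂z^i` and `∂/∂z̄^j`. -/
def complexPairing {κ : Type} [Fintype κ] (G : Matrix κ κ ℝ) (a b : κ → ℂ) : ℂ :=
  2 * ∑ i, ∑ j, (G i j : ℂ) * (a i * b j)

/-- The complex multilinear extension of a curvature tensor: the vector `R(a, b) c`. -/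
def complexCurvature {κ : Type} [Fintype κ] (R : κ → κ → κ → κ → ℝ) (a b c : κ → ℂ) : κ → ℂ :=
  fun i => ∑ j, ∑ k, ∑ l, (R i j k l : ℂ) * (c j * a k * b l)

/-- The components `R_{ij̄kl̄} = ∑ s, g_{is̄} R^s̄_{j̄kl̄}` of the Riemannian curvature tensor of a
normal Hermitian metric `∑ g_{ij̄} dz^i dz̄^j`, where
`R(∂/∂z^k, ∂/∂z̄^l) ∂/∂z̄^j = ∑ s, R^s̄_{j̄kl̄} ∂/∂z̄^s + ∑ s, R^s_{j̄kl̄} ∂/∂z^s`. The metric is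
given by its real matrix in the coordinates `y^i` (index `Sum.inl i`) and `dy^i`
(index `Sum.inr i`). -/
def kahlerCurvature (G : Model p (ι ⊕ ι) → Matrix (ι ⊕ ι) (ι ⊕ ι) ℝ) (i j k l : ι)
    (z : Model p (ι ⊕ ι)) : ℂ :=
  complexPairing (G z) (ddz i)
    (complexCurvature (fun a b c d => connectionCurvature (leviCivita G) a b c d z)
      (ddz k) (ddzbar l) (ddzbar j))

end ComplexComponents

end HessFol

end

/-! In the chart $(x,y,\eta)$ with $\eta=dy$ induced by an adapted chart, $g^N$ has the block matrix
$\mathrm{diag}(g,g)$, and its entries depend only on the base point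
(`components_normalKahlerMetric`). The theorem thus becomes a computation with Christoffel symbols.

Since $g_{ab}=\partial_a\partial_b h$, the derivatives $\partial_c g_{ab}$ are totally symmetric
(`pd_components_comm`). Two of the three terms in each Christoffel symbol of $g$ cancel, leaving
$c^i_{kj}=\tfrac12\sum_s g^{is}\partial_k g_{sj}$. The same symmetry shows that the Christoffel
symbols of $g^N$ are the complex bilinear extension of $c$ (`leviCivita_doubled`):
$\nabla_{\partial_{z^k}}\partial_{z^j}=\sum_s c^s_{kj}\,\partial_{z^s}$, the conjugate formula holds
with the same real $c$, and the mixed derivatives vanish.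

Hence $R^N(\partial_{z^k},\partial_{\bar z^l})\partial_{\bar
z^j}=\sum_s(\partial_{z^k}c^s_{lj})\,\partial_{\bar z^s}$ with no quadratic terms. On functions of
the base coordinates $\partial_{z^k}$ acts as $\tfrac12\partial_{y^k}$; this is the factor in the
theorem (`complexCurvature_doubledConnection`). As $D$ has zero coefficients in affine coordinates,
$\gamma=c$ and $Q^s_{jkl}=\partial_k c^s_{jl}$. Lowering $s$ with $g$ gives the claim
(`complexPairing_ddz_ddzbar`). -/

namespace HessFol

/-! ### Curvature of a doubled Hessian metric in coordinates -/

/-! ### Functions pulled back from the base and their partial derivatives. -/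

section Coordinates

variable {p : ℕ} {ι : Type}

/-- The projection `(x, y, η) ↦ (x, y)`. -/
def baseProj (p : ℕ) (ι : Type) : Model p (ι ⊕ ι) →L[ℝ] Model p ι where
  toFun w := (w.1, w.2 ∘ Sum.inl)
  map_add' _ _ := rfl
  map_smul' _ _ := rfl
  cont := by fun_prop

@[simp]
lemma baseProj_apply (w : Model p (ι ⊕ ι)) : baseProj p ι w = (w.1, w.2 ∘ Sum.inl) := rfl

/-- The inclusion `(x, y) ↦ (x, y, 0)`. -/
def zeroSection (p : ℕ) (ι : Type) : Model p ι →L[ℝ] Model p (ι ⊕ ι) where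
  toFun w := (w.1, Sum.elim w.2 0)
  map_add' a b := by
    refine Prod.ext rfl (funext fun i => ?_)
    cases i <;> simp
  map_smul' c a := by
    refine Prod.ext rfl (funext fun i => ?_)
    cases i <;> simp
  cont := by
    refine continuous_fst.prodMk (continuous_pi fun i => ?_)
    cases i <;> simp <;> fun_prop

lemma baseProj_zeroSection (w : Model p ι) : baseProj p ι (zeroSection p ι w) = w := rfl

variable [Fintype ι]

/-- No differentiability is assumed. The projection has an affine section through `z`, so the
pullback is differentiable at `z` exactly when `f` is differentiable below; otherwise both
derivatives take the default value 0. This lets the curvature computation run for arbitrary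
coefficients `c`. -/
lemma fderiv_comp_baseProj (f : Model p ι → ℝ) (z : Model p (ι ⊕ ι)) :
    fderiv ℝ (fun w => f (baseProj p ι w)) z =
      (fderiv ℝ f (baseProj p ι z)).comp (baseProj p ι) := by
  by_cases hf : DifferentiableAt ℝ f (baseProj p ι z)
  · exact (hf.hasFDerivAt.comp z (baseProj p ι).hasFDerivAt).fderiv
  · have h : ¬ DifferentiableAt ℝ (fun w => f (baseProj p ι w)) z := by
      intro h
      apply hf
      have hs : DifferentiableAt ℝ
          (fun w => z + zeroSection p ι (w - baseProj p ι z)) (baseProj p ι z) := by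
        fun_prop
      have h' : DifferentiableAt ℝ (fun w => f (baseProj p ι w))
          (z + zeroSection p ι (baseProj p ι z - baseProj p ι z)) := by
        simpa only [sub_self, map_zero, add_zero] using h
      have := h'.comp (baseProj p ι z) hs
      refine this.congr_of_eventuallyEq (Filter.Eventually.of_forall fun w => ?_)
      simp only [Function.comp_apply, map_add, baseProj_zeroSection, map_sub, add_sub_cancel]
    rw [fderiv_zero_of_not_differentiableAt hf, fderiv_zero_of_not_differentiableAt h,
      ContinuousLinearMap.zero_comp]

variable [DecidableEq ι]

lemma pd_congr {κ : Type} [Fintype κ] [DecidableEq κ] {f f' : Model p κ → ℝ} {z : Model p κ}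
    (h : f =ᶠ[𝓝 z] f') (k : κ) : pd f k z = pd f' k z := by
  rw [pd, pd, h.fderiv_eq]

@[simp]
lemma pd_comp_baseProj_inl (f : Model p ι → ℝ) (k : ι) (z : Model p (ι ⊕ ι)) :
    pd (fun w => f (baseProj p ι w)) (Sum.inl k) z = pd f k (baseProj p ι z) := by
  have h : baseProj p ι (0, Pi.single (Sum.inl k) 1) = (0, Pi.single k 1) := by
    refine Prod.ext rfl (funext fun i => ?_)
    simp [Pi.single_apply]
  rw [pd, fderiv_comp_baseProj, ContinuousLinearMap.comp_apply, h, pd]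

@[simp]
lemma pd_comp_baseProj_inr (f : Model p ι → ℝ) (k : ι) (z : Model p (ι ⊕ ι)) :
    pd (fun w => f (baseProj p ι w)) (Sum.inr k) z = 0 := by
  have h : baseProj p ι (0, Pi.single (Sum.inr k) 1) = 0 := by
    refine Prod.ext rfl (funext fun i => ?_)
    simp
  rw [pd, fderiv_comp_baseProj, ContinuousLinearMap.comp_apply, h, map_zero]

@[simp]
lemma pd_neg {κ : Type} [Fintype κ] [DecidableEq κ] (f : Model p κ → ℝ) (k : κ)
    (z : Model p κ) : pd (fun w => -f w) k z = -pd f k z := by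
  simp [pd, fderiv_fun_neg]

@[simp]
lemma pd_zero {κ : Type} [Fintype κ] [DecidableEq κ] (k : κ)
    (z : Model p κ) : pd (fun _ => 0) k z = 0 := by
  simp [pd]

/-- Partial derivatives of a `C^2` function commute. -/
lemma pd_comm {κ : Type} [Fintype κ] [DecidableEq κ] {f : Model p κ → ℝ} {z : Model p κ}
    (hf : ContDiffAt ℝ 2 f z) (i j : κ) : pd (pd f i) j z = pd (pd f j) i z := by
  have hd : DifferentiableAt ℝ (fderiv ℝ f) z :=
    (hf.fderiv_right (m := 1) (by norm_num)).differentiableAt (by norm_num)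
  have key : ∀ a b : κ, pd (pd f a) b z =
      fderiv ℝ (fderiv ℝ f) z (0, Pi.single b 1) (0, Pi.single a 1) := by
    intro a b
    have : HasFDerivAt (pd f a) _ z := hd.hasFDerivAt.clm_apply (hasFDerivAt_const _ z)
    rw [pd, this.fderiv]
    simp
  rw [key, key]
  exact (hf.isSymmSndFDerivAt (by simp)) _ _

lemma contDiffAt_pd {κ : Type} [Fintype κ] [DecidableEq κ] {f : Model p κ → ℝ} {z : Model p κ}
    (hf : ContDiffAt ℝ ∞ f z) (i : κ) : ContDiffAt ℝ ∞ (pd f i) z :=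
  (hf.fderiv_right (m := ∞) (by simp)).clm_apply contDiffAt_const

/-! ### The doubled metric and its Christoffel symbols. -/

/-- The matrix of the metric `∑ g_{ij} dz^i dz̄^j` in the coordinates `(y^i, dy^i)`. -/
noncomputable def doubled (G : Model p ι → Matrix ι ι ℝ) (w : Model p (ι ⊕ ι)) :
    Matrix (ι ⊕ ι) (ι ⊕ ι) ℝ :=
  Matrix.fromBlocks (G (baseProj p ι w)) 0 0 (G (baseProj p ι w))

/-- The curvature differentiates the Christoffel symbols once more, so they must agree as germs and
not only at the point. -/
lemma leviCivita_congr {κ : Type} [Fintype κ] [DecidableEq κ] {G G' : Model p κ → Matrix κ κ ℝ}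
    {z : Model p κ} (h : G =ᶠ[𝓝 z] G') (i k j : κ) :
    leviCivita G i k j =ᶠ[𝓝 z] leviCivita G' i k j := by
  filter_upwards [h.eventually_nhds] with w hw
  have hpd : ∀ a b c, pd (fun w => G w a b) c w = pd (fun w => G' w a b) c w := fun a b c =>
    pd_congr (hw.mono fun v hv => by rw [hv]) c
  simp only [leviCivita, hpd, hw.self_of_nhds]

lemma connectionCurvature_congr {κ : Type} [Fintype κ] [DecidableEq κ]
    {C C' : κ → κ → κ → Model p κ → ℝ} {z : Model p κ}
    (h : ∀ i k j, C i k j =ᶠ[𝓝 z] C' i k j) (i j k l : κ) :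
    connectionCurvature C i j k l z = connectionCurvature C' i j k l z := by
  simp only [connectionCurvature, pd_congr (h _ _ _), (h _ _ _).self_of_nhds]

/-- Torsion-freeness in a coordinate frame. -/
lemma leviCivita_symm {κ : Type} [Fintype κ] [DecidableEq κ] {G : Model p κ → Matrix κ κ ℝ}
    (hG : ∀ w a b, G w a b = G w b a) (i k j : κ) (z : Model p κ) :
    leviCivita G i k j z = leviCivita G i j k z := by
  simp only [leviCivita, hG _ k j]
  congr 1
  exact Finset.sum_congr rfl fun s _ => by ring

/-- The Christoffel symbols of the doubled metric, expressed by those `c` of the given Hessian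
metric: `c` is extended complex bilinearly. -/
noncomputable def doubledConnection (c : ι → ι → ι → Model p ι → ℝ) :
    ι ⊕ ι → ι ⊕ ι → ι ⊕ ι → Model p (ι ⊕ ι) → ℝ
  | .inl i, .inl k, .inl j => fun w => c i k j (baseProj p ι w)
  | .inl i, .inr k, .inr j => fun w => -c i k j (baseProj p ι w)
  | .inr i, .inl k, .inr j => fun w => c i k j (baseProj p ι w)
  | .inr i, .inr k, .inl j => fun w => c i k j (baseProj p ι w)
  | _, _, _ => fun _ => 0

/-- Fibre derivatives of the metric vanish and so do its mixed blocks; therefore a symbol survives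
only if it has an even number of fibre indices. Total symmetry of $\partial g$ identifies each
surviving symbol with $\pm c$. -/
lemma leviCivita_doubled {G : Model p ι → Matrix ι ι ℝ} {w : Model p (ι ⊕ ι)}
    (hG : ∀ a b v, G v a b = G v b a)
    (hC : ∀ a b c, pd (fun v => G v a b) c (baseProj p ι w) =
      pd (fun v => G v c b) a (baseProj p ι w)) (i k j : ι ⊕ ι) :
    leviCivita (doubled G) i k j w = doubledConnection (leviCivita G) i k j w := by
  have hinv : (doubled G w)⁻¹ =
      Matrix.fromBlocks (G (baseProj p ι w))⁻¹ 0 0 (G (baseProj p ι w))⁻¹ := by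
    -- The two diagonal blocks coincide, so they are invertible or singular together, which is all
    -- that the block formula for `⁻¹` needs.
    rw [doubled, Matrix.inv_fromBlocks_zero₁₂_of_isUnit_iff _ _ _ Iff.rfl]
    simp
  have hC1 : ∀ s j k, pd (fun v => G v s k) j (baseProj p ι w) =
      pd (fun v => G v s j) k (baseProj p ι w) := fun s j k => by
    rw [hC]
    simp only [hG j k]
    rw [hC]
  have hsum : ∀ s k j, pd (fun v => G v s j) k (baseProj p ι w) +
      pd (fun v => G v s k) j (baseProj p ι w) - pd (fun v => G v k j) s (baseProj p ι w) =
      pd (fun v => G v s j) k (baseProj p ι w) := fun s k j => by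
    rw [hC1 s j k, hC k j s]; ring
  have hl : ∀ a b c, pd (fun v => G (baseProj p ι v) a b) (Sum.inl c) w =
      pd (fun v => G v a b) c (baseProj p ι w) := fun a b c =>
    pd_comp_baseProj_inl (fun v => G v a b) c w
  have hr : ∀ a b c, pd (fun v => G (baseProj p ι v) a b) (Sum.inr c) w = 0 := fun a b c =>
    pd_comp_baseProj_inr (fun v => G v a b) c w
  rw [leviCivita, hinv]
  rcases i with i | i <;> rcases k with k | k <;> rcases j with j | j <;>
    simp only [doubled, doubledConnection, leviCivita, Fintype.sum_sum_type,
      Matrix.fromBlocks_apply₁₁, Matrix.fromBlocks_apply₁₂, Matrix.fromBlocks_apply₂₁,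
      Matrix.fromBlocks_apply₂₂, Matrix.zero_apply, pd_zero, hl, hr, hsum, zero_mul, mul_zero,
      add_zero, zero_add, sub_zero, zero_sub, Finset.sum_const_zero, mul_neg,
      neg_zero, Finset.sum_neg_distrib]
  -- The remaining cases have two lower fibre indices, or an upper and a first lower one. In the
  -- former only $-\partial_s g_{kj}$ survives, whence the sign; in the latter only $\partial_j
  -- g_{sk}$. Both equal $\partial_k g_{sj}$ up to that sign.
  all_goals
    try rw [neg_inj]
    congr 1
    refine Finset.sum_congr rfl fun s _ => ?_
    congr 1
    first
      | exact (hC _ _ _).symm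
      | exact hC1 _ _ _

/-! ### Curvature and metric in the complex frame. -/

lemma sum_mul_ddz (F : ι ⊕ ι → ℂ) (i : ι) :
    ∑ a, F a * ddz i a = (F (Sum.inl i) - Complex.I * F (Sum.inr i)) / 2 := by
  simp [ddz, Fintype.sum_sum_type, Pi.single_apply]
  ring

lemma sum_mul_ddzbar (F : ι ⊕ ι → ℂ) (i : ι) :
    ∑ a, F a * ddzbar i a = (F (Sum.inl i) + Complex.I * F (Sum.inr i)) / 2 := by
  simp [ddzbar, Fintype.sum_sum_type, Pi.single_apply]
  ring

/-- `R(∂/∂z^k, ∂/∂z̄^l) ∂/∂z̄^j = ½ ∑ s, ∂c^s_{lj}/∂y^k ∂/∂z̄^s` for the doubled connection. -/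
lemma complexCurvature_doubledConnection (c : ι → ι → ι → Model p ι → ℝ)
    (z : Model p (ι ⊕ ι)) (j k l : ι) :
    complexCurvature
      (fun a b c' d => connectionCurvature (doubledConnection c) a b c' d z)
      (ddz k) (ddzbar l) (ddzbar j) =
    ∑ s, ((1 / 2 * pd (c s l j) k (baseProj p ι z) : ℝ) : ℂ) • ddzbar s := by
  funext a
  -- Nesting the sums allows the complex vectors to be contracted one slot at a time.
  have h1 : ∀ F : ι ⊕ ι → ι ⊕ ι → ι ⊕ ι → ℂ,
      ∑ x, ∑ y, ∑ t, F x y t * (ddzbar j x * ddz k y * ddzbar l t) =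
      ∑ x, (∑ y, (∑ t, F x y t * ddzbar l t) * ddz k y) * ddzbar j x := by
    intro F
    simp only [Finset.sum_mul]
    refine Finset.sum_congr rfl fun x _ => Finset.sum_congr rfl fun y _ =>
      Finset.sum_congr rfl fun t _ => by ring
  have hl : ∀ i k j m, pd (fun v => c i k j (baseProj p ι v)) (Sum.inl m) z =
      pd (c i k j) m (baseProj p ι z) := fun i k j m => pd_comp_baseProj_inl (c i k j) m z
  have hr : ∀ i k j m, pd (fun v => c i k j (baseProj p ι v)) (Sum.inr m) z = 0 :=
    fun i k j m => pd_comp_baseProj_inr (c i k j) m z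
  rw [complexCurvature, h1]
  simp only [sum_mul_ddz, sum_mul_ddzbar, Finset.sum_apply, Pi.smul_apply, smul_eq_mul]
  have hI := Complex.I_sq
  rcases a with s | s <;>
    simp only [connectionCurvature, doubledConnection, pd_neg, pd_zero, hl, hr,
      Fintype.sum_sum_type, mul_zero, zero_mul, sub_zero, zero_sub, sub_self,
      Finset.sum_const_zero, add_zero, zero_add, neg_mul, mul_neg, neg_neg, neg_zero, ddzbar,
      Finset.sum_sub_distrib, Finset.sum_neg_distrib, Complex.ofReal_add, Complex.ofReal_neg,
      Complex.ofReal_sub, Complex.ofReal_zero, Sum.elim_inl, Sum.elim_inr]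
  all_goals
    simp only [Pi.single_apply, mul_ite, mul_zero, Finset.sum_ite_eq, Finset.mem_univ, if_true,
      Complex.ofReal_mul, Complex.ofReal_div, Complex.ofReal_one, Complex.ofReal_ofNat]
    -- `S` and `S'` are the quadratic terms. Each has total coefficient 0 once `I ^ 2 = -1` is used,
    -- because mixed products of $\partial_z$ and $\partial_{\bar z}$ vanish.
    generalize ((∑ x, c s k x (baseProj p ι z) * c x l j (baseProj p ι z) : ℝ) : ℂ) = S
    generalize ((∑ x, c s l x (baseProj p ι z) * c x k j (baseProj p ι z) : ℝ) : ℂ) = S'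
    grind

/-- The blocks contribute $\tfrac12\cdot\tfrac12$ and $(-\tfrac i2)(\tfrac i2)$, that is $\tfrac14$
each; the factor 2 in `complexPairing` normalizes the sum to 1. -/
lemma complexPairing_ddz_ddzbar (G : Matrix ι ι ℝ) (i : ι) (v : ι → ℝ) :
    complexPairing (Matrix.fromBlocks G 0 0 G) (ddz i) (∑ s, (v s : ℂ) • ddzbar s) =
      ((∑ s, G i s * v s : ℝ) : ℂ) := by
  have h : ∀ F : ι ⊕ ι → ι ⊕ ι → ℂ, ∀ w : ι ⊕ ι → ℂ,
      ∑ a, ∑ b, F a b * (ddz i a * w b) = ∑ a, (∑ b, F a b * w b) * ddz i a := by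
    intro F w
    simp only [Finset.sum_mul]
    exact Finset.sum_congr rfl fun a _ => Finset.sum_congr rfl fun b _ => by ring
  have hI := Complex.I_sq
  rw [complexPairing, h, sum_mul_ddz]
  simp only [Fintype.sum_sum_type, ddzbar, Finset.sum_apply, Pi.smul_apply, smul_eq_mul,
    Sum.elim_inl, Sum.elim_inr, Matrix.fromBlocks_apply₁₁, Matrix.fromBlocks_apply₁₂,
    Matrix.fromBlocks_apply₂₁, Matrix.fromBlocks_apply₂₂, Matrix.zero_apply, Pi.single_apply]
  push_cast
  simp only [mul_ite, mul_zero, Finset.sum_ite_eq, Finset.mem_univ, if_true,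
    zero_mul, Finset.sum_const_zero, add_zero, zero_add]
  rw [Finset.mul_sum, ← Finset.sum_sub_distrib, Finset.sum_div, Finset.mul_sum]
  exact Finset.sum_congr rfl fun s _ => by grind

end Coordinates

/-! ### The matrix of $g^N$ in an arbitrary induced chart. -/

section Metric

variable {p : ℕ} {ι : Type} [Fintype ι] [DecidableEq ι] {M : Type*} [TopologicalSpace M]
  [ChartedSpace (Model p ι) M]

lemma bilin_eq_sum {κ V : Type*} [Fintype κ] [DecidableEq κ] [AddCommGroup V] [Module ℝ V]
    (B : LinearMap.BilinForm ℝ V) (f : (κ → ℝ) →ₗ[ℝ] V) (ξ η : κ → ℝ) :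
    B (f ξ) (f η) = ∑ i, ∑ j, B (f (Pi.single i 1)) (f (Pi.single j 1)) * (ξ i * η j) := by
  have h : ∀ ξ : κ → ℝ, f ξ = ∑ i, ξ i • f (Pi.single i 1) := fun ξ => by
    rw [LinearMap.pi_apply_eq_sum_univ f ξ]
    refine Finset.sum_congr rfl fun i _ => ?_
    congr 2
    funext j
    simp [Pi.single_apply, eq_comm]
  rw [h ξ, h η]
  simp only [map_sum, LinearMap.sum_apply, map_smul, LinearMap.smul_apply, smul_eq_mul,
    Finset.mul_sum]
  rw [Finset.sum_comm]
  exact Finset.sum_congr rfl fun i _ => Finset.sum_congr rfl fun j _ => by ring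

lemma components_apply_of_mem {g : ∀ x : M, LinearMap.BilinForm ℝ (NormalSpace p ι x)}
    {e : OpenPartialHomeomorph M (Model p ι)} {x : M} (hx : x ∈ e.source) (i j : ι) :
    components g e (e x) i j =
      g x (normalFrame e x (Pi.single i 1)) (normalFrame e x (Pi.single j 1)) := by
  rw [components, Matrix.of_apply, e.left_inv hx]

lemma components_symm (g : FoliatedHessianMetric p ι M) (e : OpenPartialHomeomorph M (Model p ι))
    (z : Model p ι) (i j : ι) : components g.inner e z i j = components g.inner e z j i :=
  g.symm _ _ _

variable [HasGroupoid M (affineFoliationGroupoid p ι)]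

-- The topology of the bundle is given only by its charts, and in an induced chart the projection
-- just forgets the fibre coordinates.
omit [DecidableEq ι] in
lemma normalChart_continuousAt_proj (e : OpenPartialHomeomorph M (Model p ι))
    (he : e ∈ AffineCharts p ι M) {u : NormalBundle p ι M} (hu : u.proj ∈ e.source) :
    ContinuousAt (NormalBundle.proj : NormalBundle p ι M → M) u := by
  have hu' : u ∈ (normalChart e he).source := hu
  have h1 : ContinuousAt (fun w : NormalBundle p ι M =>
      e.symm ((normalChart e he w).1, (normalChart e he w).2 ∘ Sum.inl)) u := by
    have h2 : ContinuousAt (normalChart e he) u := (normalChart e he).continuousAt hu'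
    have h3 : ContinuousAt (fun w : Model p (ι ⊕ ι) => ((w.1, w.2 ∘ Sum.inl) : Model p ι))
      (normalChart e he u) := by fun_prop
    have h4 : ContinuousAt e.symm ((normalChart e he u).1, (normalChart e he u).2 ∘ Sum.inl) :=
      e.continuousAt_symm (e.map_source hu)
    exact ContinuousAt.comp (f := fun w : NormalBundle p ι M =>
      (((normalChart e he w).1, (normalChart e he w).2 ∘ Sum.inl) : Model p ι)) h4
      (ContinuousAt.comp (g := fun w : Model p (ι ⊕ ι) => ((w.1, w.2 ∘ Sum.inl) : Model p ι))
        h3 h2)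
  refine h1.congr ?_
  filter_upwards [(normalChart e he).open_source.mem_nhds hu'] with w hw
  exact e.left_inv hw

omit [DecidableEq ι] in
/-- The transverse coordinates of two induced charts are related by a doubled affine map. -/
lemma normalChart_transition_affine {e e' : OpenPartialHomeomorph M (Model p ι)}
    (he : e ∈ AffineCharts p ι M) (he' : e' ∈ AffineCharts p ι M) {u : NormalBundle p ι M}
    (hu : u.proj ∈ e.source) (hu' : u.proj ∈ e'.source) :
    ∃ L : (ι → ℝ) →ₗ[ℝ] (ι → ℝ),
      (∀ a, normalDy e' u.proj a = L (normalDy e u.proj a)) ∧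
      ∀ a i, normalDy (normalChart e' he') u a (Sum.inl i) =
          L (normalDy (normalChart e he) u a ∘ Sum.inl) i ∧
        normalDy (normalChart e' he') u a (Sum.inr i) =
          L (normalDy (normalChart e he) u a ∘ Sum.inr) i := by
  obtain ⟨L, b, h⟩ := transition_affine he he' hu hu'
  refine ⟨L, normalDy_eq_of_affine he he' hu hu' h, ?_⟩
  let D : (ι ⊕ ι → ℝ) →ₗ[ℝ] (ι ⊕ ι → ℝ) :=
    { toFun := fun y => Sum.elim (L (y ∘ Sum.inl)) (L (y ∘ Sum.inr))
      map_add' := fun y y' => by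
        funext i
        rcases i with i | i
        · exact congrFun (L.map_add (y ∘ Sum.inl) (y' ∘ Sum.inl)) i
        · exact congrFun (L.map_add (y ∘ Sum.inr) (y' ∘ Sum.inr)) i
      map_smul' := fun c y => by
        funext i
        rcases i with i | i
        · exact congrFun (L.map_smul c (y ∘ Sum.inl)) i
        · exact congrFun (L.map_smul c (y ∘ Sum.inr)) i }
  -- The translation `b` enters only the base half, as the fibre coordinates are differentials. One
  -- pair `L`, `b` serves all nearby points, so the bundle's own transverse change is affine with
  -- linear part `D`.
  have hD : ∀ᶠ w in 𝓝 u, (normalChart e' he' w).2 =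
      D (normalChart e he w).2 + Sum.elim b 0 := by
    have hp := normalChart_continuousAt_proj e he hu
    filter_upwards [hp.eventually h.eventually_nhds, hp (e.open_source.mem_nhds hu),
      hp (e'.open_source.mem_nhds hu')] with w hw hw1 hw2
    change Sum.elim (e' w.proj).2 (normalDy e' w.proj w.vec) =
      Sum.elim (L (e w.proj).2) (L (normalDy e w.proj w.vec)) + Sum.elim b 0
    rw [normalDy_eq_of_affine he he' hw1 hw2 hw, hw.self_of_nhds]
    funext i
    rcases i with i | i <;> simp
  intro a i
  have ha := normalDy_eq_of_affine (normalChart_mem e he) (normalChart_mem e' he')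
    (x := u) hu hu' hD a
  rw [ha]
  exact ⟨rfl, rfl⟩

/-- The metric `g^N` in an arbitrary induced chart: its definition does not depend on the
preferred chart. -/
lemma normalKahlerMetric_apply (g : FoliatedHessianMetric p ι M)
    {e : OpenPartialHomeomorph M (Model p ι)} (he : e ∈ AffineCharts p ι M)
    {u : NormalBundle p ι M} (hu : u.proj ∈ e.source) (a b : NormalSpace p (ι ⊕ ι) u) :
    normalKahlerMetric g u a b =
      g.inner u.proj (normalFrame e u.proj (normalDy (normalChart e he) u a ∘ Sum.inl))
        (normalFrame e u.proj (normalDy (normalChart e he) u b ∘ Sum.inl)) +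
      g.inner u.proj (normalFrame e u.proj (normalDy (normalChart e he) u a ∘ Sum.inr))
        (normalFrame e u.proj (normalDy (normalChart e he) u b ∘ Sum.inr)) := by
  have hc := (affineFoliationGroupoid p ι).chart_mem_maximalAtlas u.proj
  have hxc := mem_chart_source (Model p ι) u.proj
  obtain ⟨L, hL, hN⟩ := normalChart_transition_affine he hc hu hxc
  have hframe : ∀ ξ, normalFrame e u.proj ξ =
      normalFrame (chartAt (Model p ι) u.proj) u.proj (L ξ) := fun ξ => by
    rw [← normalDy_normalFrame he hu ξ, ← hL, normalFrame_normalDy hc hxc,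
      normalDy_normalFrame he hu]
  rw [hframe, hframe, hframe, hframe, bilin_eq_sum, bilin_eq_sum, ← Finset.sum_add_distrib]
  simp only [normalKahlerMetric, LinearMap.mk₂_apply]
  rw [Complex.re_sum]
  refine Finset.sum_congr rfl fun i _ => ?_
  rw [Complex.re_sum, ← Finset.sum_add_distrib]
  refine Finset.sum_congr rfl fun j _ => ?_
  -- The real part of $(\alpha+i\beta)\overline{(\alpha'+i\beta')}$ is $\alpha\alpha'+\beta\beta'$:
  -- one copy of $g$ for each half of the coordinates.
  rw [components_apply_of_mem hxc, Complex.re_ofReal_mul, dz, dz, (hN a i).1, (hN a i).2,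
    (hN b j).1, (hN b j).2]
  simp
  ring

/-- By `normalKahlerMetric_apply` the two halves of the coordinates are orthogonal and each carries
$g$ at the base point. This identifies $g^N$ locally with `doubled`. -/
lemma components_normalKahlerMetric (g : FoliatedHessianMetric p ι M)
    {e : OpenPartialHomeomorph M (Model p ι)} (he : e ∈ AffineCharts p ι M)
    {w : Model p (ι ⊕ ι)} (hw : w ∈ (normalChart e he).target) :
    components (normalKahlerMetric g) (normalChart e he) w =
      Matrix.fromBlocks (components g.inner e (w.1, w.2 ∘ Sum.inl)) 0 0
        (components g.inner e (w.1, w.2 ∘ Sum.inl)) := by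
  have hu : (normalChart e he).symm w ∈ (normalChart e he).source :=
    (normalChart e he).map_target hw
  have hl : ∀ i : ι, (Pi.single (Sum.inl i) 1 : ι ⊕ ι → ℝ) ∘ Sum.inl = Pi.single i 1 :=
    fun i => funext fun j => by simp [Pi.single_apply]
  have hr : ∀ i : ι, (Pi.single (Sum.inr i) 1 : ι ⊕ ι → ℝ) ∘ Sum.inr = Pi.single i 1 :=
    fun i => funext fun j => by simp [Pi.single_apply]
  have hlr : ∀ i : ι, (Pi.single (Sum.inl i) 1 : ι ⊕ ι → ℝ) ∘ Sum.inr = 0 :=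
    fun i => funext fun j => by simp
  have hrl : ∀ i : ι, (Pi.single (Sum.inr i) 1 : ι ⊕ ι → ℝ) ∘ Sum.inl = 0 :=
    fun i => funext fun j => by simp
  ext a b
  rw [components, Matrix.of_apply, normalKahlerMetric_apply g he hu,
    normalDy_normalFrame (normalChart_mem e he) hu, normalDy_normalFrame (normalChart_mem e he) hu]
  rcases a with i | i <;> rcases b with j | j <;>
    simp only [hl, hr, hlr, hrl, map_zero, LinearMap.zero_apply, add_zero, zero_add,
      Matrix.fromBlocks_apply₁₁, Matrix.fromBlocks_apply₁₂, Matrix.fromBlocks_apply₂₁,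
      Matrix.fromBlocks_apply₂₂, Matrix.zero_apply] <;> rfl

end Metric

/-! ### Symmetry of the derivatives of a Hessian metric, and the curvature identity. -/

section KahlerCurvature

variable {p : ℕ} {ι : Type} [Fintype ι] [DecidableEq ι] {M : Type*} [TopologicalSpace M]
  [ChartedSpace (Model p ι) M]

/-- The first derivatives `∂g_{ab}/∂y^c` of a Hessian metric are totally symmetric. -/
lemma pd_components_comm (g : FoliatedHessianMetric p ι M)
    {e : OpenPartialHomeomorph M (Model p ι)} (he : e ∈ AffineCharts p ι M) {z : Model p ι}
    (hz : z ∈ e.target) (a b c : ι) :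
    pd (fun v => components g.inner e v a b) c z =
      pd (fun v => components g.inner e v c b) a z := by
  obtain ⟨h, W, hW, hzW, hh, hG⟩ := g.hessian e he z hz
  have hH : ContDiffAt ℝ ∞ (fun w : Model p ι => h w.2) z :=
    (hh.contDiffAt (hW.mem_nhds hzW)).comp z contDiffAt_snd
  rw [pd_congr (hG.mono fun w hw => hw a b), pd_congr (hG.mono fun w hw => hw c b)]
  -- Both sides are second derivatives of $\partial_b h$, in the directions $a$ and $c$.
  exact pd_comm (contDiffAt_infty.1 (contDiffAt_pd hH b) 2) a c

variable [HasGroupoid M (affineFoliationGroupoid p ι)]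

/-- The curvature of the normal Kähler metric is half the normal Hessian curvature:
`R^N_{ij̄kl̄} = ½ Q_{ijkl} ∘ π`. -/
theorem kahlerCurvature_normalKahlerMetric (g : FoliatedHessianMetric p ι M)
    (e : OpenPartialHomeomorph M (Model p ι)) (he : e ∈ AffineCharts p ι M)
    (u : NormalBundle p ι M) (hu : u.proj ∈ e.source) (i j k l : ι) :
    kahlerCurvature (components (normalKahlerMetric g) (normalChart e he)) i j k l
        (normalChart e he u) =
      (((1 / 2) * hessianCurvature g e i j k l (e u.proj) : ℝ) : ℂ) := by
  have hut : normalChart e he u ∈ (normalChart e he).target :=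
    (normalChart e he).map_source (show u ∈ (normalChart e he).source from hu)
  have hbase : baseProj p ι (normalChart e he u) = e u.proj := rfl
  have hG : components (normalKahlerMetric g) (normalChart e he) =ᶠ[𝓝 (normalChart e he u)]
      doubled (components g.inner e) := by
    filter_upwards [(normalChart e he).open_target.mem_nhds hut] with w hw
    exact components_normalKahlerMetric g he hw
  have hsymm : ∀ a b v, components g.inner e v a b = components g.inner e v b a :=
    fun a b v => components_symm g e v a b
  have hC : ∀ a c b, leviCivita (components (normalKahlerMetric g) (normalChart e he)) a c b
      =ᶠ[𝓝 (normalChart e he u)] doubledConnection (leviCivita (components g.inner e)) a c b := by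
    intro a c b
    refine (leviCivita_congr hG a c b).trans ?_
    filter_upwards [(normalChart e he).open_target.mem_nhds hut] with w hw
    exact leviCivita_doubled hsymm (fun _ _ _ => pd_components_comm g he hw _ _ _) a c b
  -- The curvature produces $c^s_{lj}$ whereas $Q$ is built from $\gamma^s_{jl}$; torsion-freeness
  -- reconciles the index order.
  have hLC : ∀ s, leviCivita (components g.inner e) s l j =
      differenceTensor (components g.inner e) s j l := fun s => funext fun w => by
    rw [differenceTensor, flatConnection, sub_zero,
      leviCivita_symm (fun v a b => hsymm a b v) s l j w]
  simp only [kahlerCurvature, connectionCurvature_congr hC]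
  rw [complexCurvature_doubledConnection, hG.self_of_nhds, doubled, complexPairing_ddz_ddzbar,
    hbase, hessianCurvature, Finset.mul_sum]
  congr 1
  refine Finset.sum_congr rfl fun s _ => ?_
  simp only [covDerivTensor, flatConnection, zero_mul, sub_zero,
    Finset.sum_const_zero, add_zero, hLC]
  ring

end KahlerCurvature

end HessFol

theorem mainTheorem9 {p q : ℕ} {M : Type*} [TopologicalSpace M]
    [ChartedSpace (HessFol.Model p (Fin q)) M]
    [HasGroupoid M (HessFol.affineFoliationGroupoid p (Fin q))]
    (g : HessFol.FoliatedHessianMetric p (Fin q) M)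
    (e : OpenPartialHomeomorph M (HessFol.Model p (Fin q)))
    (he : e ∈ HessFol.AffineCharts p (Fin q) M)
    (u : HessFol.NormalBundle p (Fin q) M) (hu : u.proj ∈ e.source) (i j k l : Fin q) :
    HessFol.kahlerCurvature
        (HessFol.components (HessFol.normalKahlerMetric g) (HessFol.normalChart e he)) i j k l
        (HessFol.normalChart e he u) =
      (((1 / 2) * HessFol.hessianCurvature g e i j k l (e u.proj) : ℝ) : ℂ) :=
  HessFol.kahlerCurvature_normalKahlerMetric g e he u hu i j k l
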